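/- Let $\Gamma$ be a finite set with $N=\operatorname{card}\Gamma>1$ elements and let $J,Q\ge 1$ be integers. Let $\mathcal D_N$ be the Dyck inverse monoid, that is, the monoid with zero that is generated by $\gamma(-),\gamma(+)$, $\gamma\in\Gamma$, subject to the relations $\gamma(-)\gamma(+)=\mathbf 1$ and $\gamma(-)\gamma'(+)=0$ for $\gamma\ne\gamma'$. Let $G_{\bigcirc}(N,J,Q)$ be the directed graph that consists of $J$ directed circles, each made up of $Q$ edges, which have exactly one vertex $v_{\bigcirc}$ in common, together with loops $e(\gamma(-))$ and $e(\gamma(+))$ at $v_{\bigcirc}$, one of each for every $\gamma\in\Gamma$. Set $\varphi(e(\gamma(-)))=\gamma(-)$, $\varphi(e(\gamma(+)))=\gamma(+)$, and $\varphi(e)=\mathbf 1$ for the edges $e$ of the circles. Let $X(G_{\bigcirc}(N,J,Q))$ be the subshift, with the set of edges of $G_{\bigcirc}(N,J,Q)$ as its alphabet, whose admissible words are the finite paths $e_1e_2\cdots e_I$ in $G_{\bigcirc}(N,J,Q)$ such that $\varphi(e_1)\varphi(e_2)\cdots\varphi(e_I)\neq 0$ in $\mathcal D_N$. Then the equation $$z^Q+\frac{N+1}{J}\,z-\frac1J=0$$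 has exactly one positive real root $z_0$, and the topological entropy of $X(G_{\bigcirc}(N,J,Q))$ is $-\log z_0$. That is, if $\mathcal L_n$ denotes the set of words of length $n$ that appear in points of $X(G_{\bigcirc}(N,J,Q))$, then $$\lim_{n\to\infty}\frac1n\log\operatorname{card}\mathcal L_n=-\log z_0 .$$ -/

import Mathlib

open Filter Topology

/-! ### Subshifts, admissible words, topological entropy -/

section Subshifts

variable {A : Type*}

/-- A subshift over the alphabet `A`: a shift-invariant subset of `A^ℤ` that is closed in the
product of the discrete topologies. -/
structure Subshift (A : Type*) where
  carrier : Set (ℤ → A)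
  isClosed : @IsClosed (ℤ → A) (@Pi.topologicalSpace ℤ (fun _ => A) (fun _ => ⊥)) carrier
  shift_mem_iff : ∀ x : ℤ → A, (fun i => x (i + 1)) ∈ carrier ↔ x ∈ carrier

/-- The word `x_i x_{i+1} … x_{i+n-1}`. -/
def wordAt (x : ℤ → A) (i : ℤ) (n : ℕ) : List A :=
  List.ofFn fun k : Fin n => x (i + (k : ℕ))

/-- The language of a subshift: the words that appear somewhere in one of its points. -/
def Subshift.language (X : Subshift A) : Set (List A) :=
  {w | ∃ x ∈ X.carrier, ∃ (i : ℤ) (n : ℕ), wordAt x i n = w}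

/-- The words of length `n` in the language. -/
def Subshift.languageOfLength (X : Subshift A) (n : ℕ) : Set (List A) :=
  {w | w ∈ X.language ∧ w.length = n}

/-- `X.HasEntropy h` says that `(1/n) log card L_n(X)` converges to `h`. -/
def Subshift.HasEntropy (X : Subshift A) (h : ℝ) : Prop :=
  Tendsto (fun n : ℕ => 1 / (n : ℝ) * Real.log ((X.languageOfLength n).ncard : ℝ)) atTop (𝓝 h)

/-- The subshift of all points all of whose finite words belong to the set of words `S`.
If `S` is closed under subwords, and its words can be extended within `S` on both sides, then
its language is `S` (`language_subshiftOfWords`). -/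
def subshiftOfWords (S : Set (List A)) : Subshift A where
  carrier := {x | ∀ (i : ℤ) (n : ℕ), wordAt x i n ∈ S}
  isClosed := by
    let _ : TopologicalSpace A := ⊥
    have : DiscreteTopology A := ⟨rfl⟩
    have h : {x : ℤ → A | ∀ (i : ℤ) (n : ℕ), wordAt x i n ∈ S} =
        ⋂ (i : ℤ), ⋂ (n : ℕ), (fun (x : ℤ → A) (k : Fin n) => x (i + (k : ℕ))) ⁻¹'
          {f | List.ofFn f ∈ S} := by
      ext x; simp [wordAt]
    rw [h]
    refine isClosed_iInter fun i => isClosed_iInter fun n => ?_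
    refine IsClosed.preimage ?_ (isClosed_discrete _)
    exact continuous_pi fun k => continuous_apply _
  shift_mem_iff := fun x => by
    have key : ∀ (i : ℤ) (n : ℕ), wordAt (fun j => x (j + 1)) i n = wordAt x (i + 1) n := by
      intro i n
      simp only [wordAt]
      congr 1
      funext k
      congr 1
      ring
    constructor
    · intro h i n
      have := h (i - 1) n
      rw [key] at this
      simpa using this
    · intro h i n
      rw [key]
      exact h _ _

/-- A factorial and extendable set of words is the language of its subshift. -/
theorem language_subshiftOfWords {S : Set (List A)}
    (hfac : ∀ u v w : List A, u ++ v ++ w ∈ S → v ∈ S)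
    (hext : ∀ w ∈ S, ∃ a b : A, a :: (w ++ [b]) ∈ S) :
    (subshiftOfWords S).language = S := by
  ext w
  constructor
  · rintro ⟨x, hx, i, n, rfl⟩
    exact hx i n
  · intro hw
    obtain ⟨l, r, hlr⟩ : ∃ l r : List A → A, ∀ v ∈ S, l v :: (v ++ [r v]) ∈ S := by
      have : Nonempty A := ⟨(hext w hw).choose⟩
      choose! l r hlr using hext
      exact ⟨l, r, hlr⟩
    let u : ℕ → List A := fun n => Nat.rec w (fun _ v => l v :: (v ++ [r v])) n
    have u0 : u 0 = w := rfl
    have us : ∀ n, u (n + 1) = l (u n) :: (u n ++ [r (u n)]) := fun n => rfl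
    have uS : ∀ n, u n ∈ S := by
      intro n
      induction n with
      | zero => exact hw
      | succ n ih => rw [us]; exact hlr _ ih
    have ulen : ∀ n, (u n).length = w.length + 2 * n := by
      intro n
      induction n with
      | zero => simp [u0]
      | succ n ih => rw [us]; simp [ih]; ring
    have ucons : ∀ n d k : ℕ, k < (u n).length → (u (n + d))[k + d]? = (u n)[k]? := by
      intro n d
      induction d with
      | zero => intro k _; rfl
      | succ d ih =>
        intro k hk
        rw [← add_assoc, us, ← add_assoc, List.getElem?_cons_succ, List.getElem?_append_left,
          ih k hk]
        rw [ulen] at hk ⊢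
        omega
    have hidx : ∀ i : ℤ, (i + i.natAbs + 1).toNat < (u (i.natAbs + 1)).length := by
      intro i; have := ulen (i.natAbs + 1); omega
    let x : ℤ → A := fun i => (u (i.natAbs + 1))[(i + i.natAbs + 1).toNat]'(hidx i)
    -- every position of every `u m` is a coordinate of `x`
    have hx : ∀ (m k : ℕ), k < (u m).length → (u m)[k]? = some (x ((k : ℤ) - m)) := by
      intro m k hk
      have e1 := ucons m (((k : ℤ) - m).natAbs + 1) k hk
      have e2 := ucons (((k : ℤ) - m).natAbs + 1) m
        ((k : ℤ) - m + ((k : ℤ) - m).natAbs + 1).toNat (hidx _)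
      have e3 : ((k : ℤ) - m + ((k : ℤ) - m).natAbs + 1).toNat + m =
          k + (((k : ℤ) - m).natAbs + 1) := by omega
      rw [e3, add_comm _ m, e1] at e2
      rw [e2, List.getElem?_eq_getElem (hidx _)]
    have hword : ∀ (m k n : ℕ), k + n ≤ (u m).length →
        wordAt x ((k : ℤ) - m) n = ((u m).drop k).take n := by
      intro m k n hkn
      apply List.ext_getElem?
      intro j
      by_cases hj : j < n
      · rw [List.getElem?_take_of_lt hj, List.getElem?_drop, hx m (k + j) (by omega)]
        simp only [wordAt, List.getElem?_ofFn, hj, dite_true]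
        congr 2
        push_cast
        ring
      · rw [List.getElem?_eq_none (by simp [wordAt]; omega),
          List.getElem?_eq_none (by simp; omega)]
    refine ⟨x, ?_, 0, w.length, ?_⟩
    · intro i n
      have h := hword (i.natAbs + n) (i + i.natAbs + n).toNat n (by rw [ulen]; omega)
      have hi : (((i + i.natAbs + n).toNat : ℕ) : ℤ) - ((i.natAbs + n : ℕ) : ℤ) = i := by omega
      rw [hi] at h
      rw [h]
      refine hfac ((u (i.natAbs + n)).take (i + i.natAbs + n).toNat) _
        (((u (i.natAbs + n)).drop (i + i.natAbs + n).toNat).drop n) ?_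
      rw [List.append_assoc, List.take_append_drop, List.take_append_drop]
      exact uS _
    · have h := hword 0 0 w.length (by simp [u0])
      simpa [u0] using h

end Subshifts

/-! ### The Dyck inverse monoid -/

/-- Generators `γ(-)`, `γ(+)` (`γ ∈ Γ`), and a zero. -/
inductive DyckGen (Γ : Type*) where
  | neg (γ : Γ) : DyckGen Γ
  | pos (γ : Γ) : DyckGen Γ
  | zero : DyckGen Γ

/-- The relations `γ(-) γ(+) = 1`, `γ(-) γ'(+) = 0` for `γ ≠ γ'`, and those that make `0` a
zero element. -/
inductive DyckRel (Γ : Type*) : FreeMonoid (DyckGen Γ) → FreeMonoid (DyckGen Γ) → Prop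
  | cancel (γ : Γ) : DyckRel Γ (FreeMonoid.of (DyckGen.neg γ) * FreeMonoid.of (DyckGen.pos γ)) 1
  | clash (γ γ' : Γ) : γ ≠ γ' →
      DyckRel Γ (FreeMonoid.of (DyckGen.neg γ) * FreeMonoid.of (DyckGen.pos γ'))
        (FreeMonoid.of DyckGen.zero)
  | zero_mul (a : DyckGen Γ) :
      DyckRel Γ (FreeMonoid.of DyckGen.zero * FreeMonoid.of a) (FreeMonoid.of DyckGen.zero)
  | mul_zero (a : DyckGen Γ) :
      DyckRel Γ (FreeMonoid.of a * FreeMonoid.of DyckGen.zero) (FreeMonoid.of DyckGen.zero)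

/-- The Dyck inverse monoid (polycyclic monoid) over `Γ`. -/
abbrev DyckInverseMonoid (Γ : Type*) : Type _ := PresentedMonoid (DyckRel Γ)

namespace DyckInverseMonoid

variable (Γ : Type*)

/-- The zero of the Dyck inverse monoid. -/
def zero : DyckInverseMonoid Γ := PresentedMonoid.of (DyckRel Γ) DyckGen.zero

variable {Γ}

/-- The generator `γ(-)`. -/
def neg (γ : Γ) : DyckInverseMonoid Γ := PresentedMonoid.of (DyckRel Γ) (DyckGen.neg γ)

/-- The generator `γ(+)`. -/
def pos (γ : Γ) : DyckInverseMonoid Γ := PresentedMonoid.of (DyckRel Γ) (DyckGen.pos γ)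

theorem neg_mul_pos_self (γ : Γ) : neg γ * pos γ = 1 :=
  PresentedMonoid.mk_eq_mk_of_rel (DyckRel.cancel γ)

theorem zero_mul_eq (a : DyckInverseMonoid Γ) : zero Γ * a = zero Γ := by
  induction a using PresentedMonoid.inductionOn with
  | _ w =>
    induction w using FreeMonoid.inductionOn' with
    | one => exact mul_one _
    | of_mul a w ih =>
      rw [map_mul, ← mul_assoc]
      have : zero Γ * PresentedMonoid.mk (DyckRel Γ) (FreeMonoid.of a) = zero Γ :=
        PresentedMonoid.mk_eq_mk_of_rel (DyckRel.zero_mul a)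
      rw [this, ih]

theorem mul_zero_eq (a : DyckInverseMonoid Γ) : a * zero Γ = zero Γ := by
  induction a using PresentedMonoid.inductionOn with
  | _ w =>
    induction w using FreeMonoid.inductionOn' with
    | one => exact one_mul _
    | of_mul a w ih =>
      rw [map_mul, mul_assoc, ih]
      exact PresentedMonoid.mk_eq_mk_of_rel (DyckRel.mul_zero a)

end DyckInverseMonoid

/-! ### Labelled directed graphs with loops attached -/

/-- A directed graph with vertices `V` and edges `E` (multiple edges and loops allowed), whose
edges are labelled by symbols from `L`. -/
structure LabeledDigraph (V E L : Type*) where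
  src : E → V
  tgt : E → V
  label : E → L

/-- A list of edges is a path if each edge starts where the preceding one ends. -/
def LabeledDigraph.IsPath {V E L : Type*} (G : LabeledDigraph V E L) (p : List E) : Prop :=
  p.IsChain fun e f => G.tgt e = G.src f

section Construction

variable {Γ V E L : Type*}

/-- `L` together with new symbols `e(γ(-), k)`, `k < Kneg γ`, and `e(γ(+), k)`, `k < Kpos γ`. -/
inductive WithLoops (L : Type*) {Γ : Type*} (Kneg Kpos : Γ → ℕ) where
  | old (a : L) : WithLoops L Kneg Kpos
  | neg (γ : Γ) (k : Fin (Kneg γ)) : WithLoops L Kneg Kpos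
  | pos (γ : Γ) (k : Fin (Kpos γ)) : WithLoops L Kneg Kpos

/-- The graph that is obtained from `G` by attaching to the vertex `v` loops `e(γ(-), k)` and
`e(γ(+), k)`, each labelled by itself. -/
def LabeledDigraph.attachLoops (G : LabeledDigraph V E L) (v : V) (Kneg Kpos : Γ → ℕ) :
    LabeledDigraph V (WithLoops E Kneg Kpos) (WithLoops L Kneg Kpos) where
  src
    | .old e => G.src e
    | .neg _ _ => v
    | .pos _ _ => v
  tgt
    | .old e => G.tgt e
    | .neg _ _ => v
    | .pos _ _ => v
  label
    | .old e => .old (G.label e)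
    | .neg γ k => .neg γ k
    | .pos γ k => .pos γ k

/-- The map `φ` on labels: `1` on the old symbols, `γ(-)` on `e(γ(-), k)`, `γ(+)` on
`e(γ(+), k)`. -/
def WithLoops.phi {Kneg Kpos : Γ → ℕ} : WithLoops L Kneg Kpos → DyckInverseMonoid Γ
  | .old _ => 1
  | .neg γ _ => DyckInverseMonoid.neg γ
  | .pos γ _ => DyckInverseMonoid.pos γ

/-- The label sequences of the admissible paths, that is, of the paths in the graph with loops
attached for which the product of the `φ`-values of the labels is not zero. -/
def admissibleWords (G : LabeledDigraph V E L) (v : V) (Kneg Kpos : Γ → ℕ) :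
    Set (List (WithLoops L Kneg Kpos)) :=
  {w | ∃ p : List (WithLoops E Kneg Kpos), (G.attachLoops v Kneg Kpos).IsPath p ∧
    (p.map fun e => ((G.attachLoops v Kneg Kpos).label e).phi).prod ≠ DyckInverseMonoid.zero Γ ∧
    p.map (G.attachLoops v Kneg Kpos).label = w}

/-- The subshift whose admissible words are the label sequences of admissible paths. -/
def loopSubshift (G : LabeledDigraph V E L) (v : V) (Kneg Kpos : Γ → ℕ) :
    Subshift (WithLoops L Kneg Kpos) :=
  subshiftOfWords (admissibleWords G v Kneg Kpos)

/-- If the graph has no dead ends besides possibly `v` (for instance, if it is irreducible), then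
the language of `loopSubshift` is indeed the declared one. -/
theorem language_loopSubshift [Nonempty Γ] (G : LabeledDigraph V E L) (v : V)
    (Kneg Kpos : Γ → ℕ) (hneg : ∀ γ, 0 < Kneg γ) (hpos : ∀ γ, 0 < Kpos γ)
    (hout : ∀ u, u ≠ v → ∃ e, G.src e = u) (hin : ∀ u, u ≠ v → ∃ e, G.tgt e = u) :
    (loopSubshift G v Kneg Kpos).language = admissibleWords G v Kneg Kpos := by
  obtain ⟨γ⟩ := ‹Nonempty Γ›
  apply language_subshiftOfWords
  · rintro a b c ⟨p, hp, hne, hw⟩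
    obtain ⟨q, r, rfl, hq, rfl⟩ := List.map_eq_append_iff.1 hw
    obtain ⟨s, t, rfl, rfl, rfl⟩ := List.map_eq_append_iff.1 hq
    refine ⟨t, ?_, ?_, rfl⟩
    · exact hp.left_of_append.right_of_append
    · intro h0
      apply hne
      simp [h0, DyckInverseMonoid.zero_mul_eq, DyckInverseMonoid.mul_zero_eq]
  · rintro w ⟨p, hp, hne, rfl⟩
    set H := G.attachLoops v Kneg Kpos with hH
    have hR : ∀ u : V, ∃ f, H.src f = u ∧
        ∀ a : DyckInverseMonoid Γ, a ≠ DyckInverseMonoid.zero Γ →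
          a * (H.label f).phi ≠ DyckInverseMonoid.zero Γ := by
      intro u
      by_cases hu : u = v
      · refine ⟨.neg γ ⟨0, hneg γ⟩, hu.symm, fun a ha h => ha ?_⟩
        change a * DyckInverseMonoid.neg γ = _ at h
        rw [← mul_one a, ← DyckInverseMonoid.neg_mul_pos_self γ, ← mul_assoc, h,
          DyckInverseMonoid.zero_mul_eq]
      · obtain ⟨e, he⟩ := hout u hu
        refine ⟨.old e, he, fun a ha h => ha ?_⟩
        change a * 1 = _ at h
        rwa [mul_one] at h
    have hL : ∀ u : V, ∃ f, H.tgt f = u ∧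
        ∀ a : DyckInverseMonoid Γ, a ≠ DyckInverseMonoid.zero Γ →
          (H.label f).phi * a ≠ DyckInverseMonoid.zero Γ := by
      intro u
      by_cases hu : u = v
      · refine ⟨.pos γ ⟨0, hpos γ⟩, hu.symm, fun a ha h => ha ?_⟩
        change DyckInverseMonoid.pos γ * a = _ at h
        rw [← one_mul a, ← DyckInverseMonoid.neg_mul_pos_self γ, mul_assoc, h,
          DyckInverseMonoid.mul_zero_eq]
      · obtain ⟨e, he⟩ := hin u hu
        refine ⟨.old e, he, fun a ha h => ha ?_⟩
        change 1 * a = _ at h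
        rwa [one_mul] at h
    obtain ⟨f, hf, hfm⟩ : ∃ f, H.IsPath (p ++ [f]) ∧
        ∀ a : DyckInverseMonoid Γ, a ≠ DyckInverseMonoid.zero Γ →
          a * (H.label f).phi ≠ DyckInverseMonoid.zero Γ := by
      obtain ⟨f, hf, hfm⟩ := hR (match p.getLast? with | some e => H.tgt e | none => v)
      refine ⟨f, ?_, hfm⟩
      refine List.isChain_append.2 ⟨hp, by simp, ?_⟩
      intro x hx y hy
      simp only [List.head?_cons, Option.mem_def, Option.some.injEq] at hx hy
      subst hy
      rw [hx] at hf
      exact hf.symm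
    obtain ⟨g, hg, hgm⟩ : ∃ g, H.IsPath (g :: (p ++ [f])) ∧
        ∀ a : DyckInverseMonoid Γ, a ≠ DyckInverseMonoid.zero Γ →
          (H.label g).phi * a ≠ DyckInverseMonoid.zero Γ := by
      obtain ⟨g, hg, hgm⟩ := hL (match (p ++ [f]).head? with | some e => H.src e | none => v)
      refine ⟨g, ?_, hgm⟩
      refine List.isChain_cons.2 ⟨?_, hf⟩
      intro y hy
      rw [Option.mem_def] at hy
      rw [hy] at hg
      exact hg
    refine ⟨H.label g, H.label f, g :: (p ++ [f]), hg, ?_, by simp [hH]⟩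
    simpa using hgm _ (hfm _ hne)

end Construction

/-! ### The bouquet of circles -/

/-- The vertices of the bouquet of `J` circles of length `Q`: a base vertex, and `v_{j,q}` for
`1 ≤ q < Q` on the `j`-th circle. -/
inductive BouquetVertex (J Q : ℕ) where
  | base : BouquetVertex J Q
  | node (j : Fin J) (q : ℕ) (one_le : 1 ≤ q) (lt : q < Q) : BouquetVertex J Q

/-- The vertex reached after `q` steps on the `j`-th circle, starting at the base. -/
def bouquetVertexAt {J Q : ℕ} (j : Fin J) (q : ℕ) : BouquetVertex J Q :=
  if h : 1 ≤ q ∧ q < Q then .node j q h.1 h.2 else .base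

/-- The bouquet of `J` circles, each made up of `Q` edges: the edge `(j, q)`, `0 ≤ q < Q`, is the
`(q + 1)`-st edge of the `j`-th circle. The edges are labelled by themselves. -/
def bouquet (J Q : ℕ) : LabeledDigraph (BouquetVertex J Q) (Fin J × Fin Q) (Fin J × Fin Q) where
  src e := bouquetVertexAt e.1 e.2
  tgt e := bouquetVertexAt e.1 (e.2 + 1)
  label e := e

/-- The subshift of the bouquet of `J` circles of length `Q`, with one loop `e(γ(-))` and one loop
`e(γ(+))` attached to the base for each `γ ∈ Γ`. -/
def bouquetSubshift (Γ : Type*) (J Q : ℕ) :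
    Subshift (WithLoops (Fin J × Fin Q) (fun _ : Γ => 1) (fun _ : Γ => 1)) :=
  loopSubshift (bouquet J Q) BouquetVertex.base (fun _ : Γ => 1) (fun _ : Γ => 1)

/-- The admissible words of `bouquetSubshift` are the label sequences of admissible paths. -/
theorem language_bouquetSubshift (Γ : Type*) [Nonempty Γ] (J Q : ℕ) :
    (bouquetSubshift Γ J Q).language =
      admissibleWords (bouquet J Q) BouquetVertex.base (fun _ : Γ => 1) (fun _ : Γ => 1) := by
  refine language_loopSubshift _ _ _ _ (fun _ => one_pos) (fun _ => one_pos) ?_ ?_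
  · rintro (_ | ⟨j, q, h1, h2⟩) hu
    · exact absurd rfl hu
    · exact ⟨(j, ⟨q, h2⟩), by simp [bouquet, bouquetVertexAt, h1]⟩
  · rintro (_ | ⟨j, q, h1, h2⟩) hu
    · exact absurd rfl hu
    · refine ⟨(j, ⟨q - 1, by omega⟩), ?_⟩
      have : q - 1 + 1 = q := by omega
      simp [bouquet, bouquetVertexAt, this, h2]

/-! Read a path from left to right and keep a stack of the unmatched `γ(-)`: each `γ(-)` pushes, and
on a nonempty stack exactly one `γ(+)` is allowed, which pops. On the empty stack all `N` symbols
`γ(+)` are allowed and leave it empty, since left multiplication by `γ(+)` never creates a zero. So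
the number of continuations of length `n` depends only on the current vertex and the stack, and
satisfies a linear recursion.

Write the equation as `J z^Q + N z + z = 1`: circles, pushes, one pop. It says that `u ↦ z ^
u.stepsToBase` is reproduced by the recursion weighted by `z` per edge, as long as the stack is
nonempty. On the empty stack the total is `J z^Q + 2 N z ≥ 1`, hence the lower bound
`pow_stepsToBase_le_continuationCount`. For the upper bound `continuationCount_le`, the surplus `(N
- 1) z ≤ 1` at the empty stack is absorbed by a correction `n * N⁻¹ ^ t.length`, whose weight is
also reproduced on nonempty stacks.

Thus `card L_n` lies between `z ^ (-n)` and a constant times `n * z ^ (-n)`, and the linear factor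
disappears in the limit. The root exists by the intermediate value theorem and is unique because the
left side is strictly increasing. -/

/-! ### Nonvanishing products in the Dyck inverse monoid. -/

namespace DyckInverseMonoid

variable {Γ : Type*}

open Classical in
/-- The action of the generators on stacks: `γ(+)` pushes `γ`, and `γ(-)` pops `γ`, if possible. -/
noncomputable def stackAction : DyckGen Γ → Function.End (Option (List Γ))
  | .pos γ => Option.map (List.cons γ)
  | .neg γ => fun s => s.bind fun t => if t.head? = some γ then some t.tail else none
  | .zero => fun _ => none

/-- The presentation does not collapse because it acts on stacks with a failure state `none`: the
unit fixes the empty stack, while the zero sends it to `none`. As the action is from the left, here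
`γ(+)` pushes and `γ(-)` pops, opposite to the reading from left to right used for counting. -/
theorem one_ne_zero : (1 : DyckInverseMonoid Γ) ≠ zero Γ := by
  have hmul : ∀ (f g : Function.End (Option (List Γ))) (s : Option (List Γ)),
      (f * g) s = f (g s) := fun _ _ _ => rfl
  have hone : ∀ s : Option (List Γ), (1 : Function.End (Option (List Γ))) s = s := fun _ => rfl
  have hrel : ∀ a b : FreeMonoid (DyckGen Γ), DyckRel Γ a b →
      FreeMonoid.lift stackAction a = FreeMonoid.lift stackAction b := by
    rintro _ _ (γ | ⟨γ, γ', h⟩ | a | a)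
    · funext s
      simp only [map_mul, map_one, FreeMonoid.lift_eval_of, hmul, hone]
      cases s <;> simp [stackAction]
    · funext s
      simp only [map_mul, FreeMonoid.lift_eval_of, hmul]
      cases s <;> simp [stackAction, h.symm]
    · funext s
      simp only [map_mul, FreeMonoid.lift_eval_of, hmul]
      cases a <;> simp [stackAction]
    · funext s
      simp only [map_mul, FreeMonoid.lift_eval_of, hmul]
      cases a <;> simp [stackAction]
  intro h
  have h1 := congrArg (PresentedMonoid.lift stackAction hrel) h
  rw [map_one, zero, PresentedMonoid.lift_of] at h1
  have h2 := congrFun h1 (some [])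
  rw [hone] at h2
  simp [stackAction] at h2

theorem neg_mul_pos_of_ne {γ γ' : Γ} (h : γ ≠ γ') : neg γ * pos γ' = zero Γ :=
  PresentedMonoid.mk_eq_mk_of_rel (DyckRel.clash γ γ' h)

/-- `γ(+)` has the left inverse `γ(-)`. This is why unmatched `γ(+)` need not be remembered. -/
theorem pos_mul_eq_zero_iff {γ : Γ} {a : DyckInverseMonoid Γ} :
    pos γ * a = zero Γ ↔ a = zero Γ := by
  refine ⟨fun h => ?_, fun h => by rw [h, mul_zero_eq]⟩
  rw [← one_mul a, ← neg_mul_pos_self γ, mul_assoc, h, mul_zero_eq]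

/-- The product of the `γ(-)` over a stack, the top of the stack (the head) being the last. -/
def negStack : List Γ → DyckInverseMonoid Γ
  | [] => 1
  | γ :: t => negStack t * neg γ

theorem negStack_ne_zero (t : List Γ) : negStack t ≠ zero Γ := by
  induction t with
  | nil => exact one_ne_zero
  | cons γ t ih =>
    intro h
    apply ih
    rw [← mul_one (negStack t), ← neg_mul_pos_self γ, ← mul_assoc]
    rw [negStack] at h
    rw [h, zero_mul_eq]

end DyckInverseMonoid

/-- The fixed length makes each fibre finite, so that `ncard` is additive over the first letter. -/
theorem Set.ncard_eq_sum_ncard_cons {A : Type*} [Fintype A] {n : ℕ} {W : Set (List A)}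
    (hW : ∀ w ∈ W, w.length = n + 1) : W.ncard = ∑ e : A, {w | e :: w ∈ W}.ncard := by
  have hfin : ∀ e : A, {w | e :: w ∈ W}.Finite := fun e =>
    (List.finite_length_eq A n).subset fun w hw => by simpa using hW _ hw
  have hU : W = ⋃ e ∈ (Set.univ : Set A), List.cons e '' {w | e :: w ∈ W} := by
    ext w
    cases w with
    | nil => simpa using fun h => absurd (hW _ h) (by simp)
    | cons e w => simp
  conv_lhs => rw [hU]
  rw [Set.Finite.ncard_biUnion Set.finite_univ (fun e _ => (hfin e).image _),
    finsum_mem_univ, finsum_eq_sum_of_fintype]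
  · exact Finset.sum_congr rfl fun e _ => Set.ncard_image_of_injective _ (List.cons_injective)
  · intro e _ f _ hef
    rw [Function.onFun, Set.disjoint_left]
    rintro _ ⟨w, _, rfl⟩ ⟨w', _, h⟩
    exact hef (List.cons.inj h).1.symm

/-! ### First-letter recursion for continuations. -/

section Loops

variable {Γ V E L : Type*}

/-- Old symbols, and one pair of new symbols for each `γ`. -/
def WithLoops.equivSum : WithLoops L (fun _ : Γ => 1) (fun _ : Γ => 1) ≃ L ⊕ Γ ⊕ Γ where
  toFun
    | .old a => .inl a
    | .neg γ _ => .inr (.inl γ)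
    | .pos γ _ => .inr (.inr γ)
  invFun
    | .inl a => .old a
    | .inr (.inl γ) => .neg γ 0
    | .inr (.inr γ) => .pos γ 0
  left_inv x := by
    rcases x with a | ⟨γ, k⟩ | ⟨γ, k⟩
    · rfl
    · simp [Subsingleton.elim k 0]
    · simp [Subsingleton.elim k 0]
  right_inv x := by rcases x with a | γ | γ <;> rfl

instance [Fintype L] [Fintype Γ] : Fintype (WithLoops L (fun _ : Γ => 1) (fun _ : Γ => 1)) :=
  Fintype.ofEquiv _ WithLoops.equivSum.symm

theorem WithLoops.sum_eq [Fintype L] [Fintype Γ] {M : Type*} [AddCommMonoid M]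
    (f : WithLoops L (fun _ : Γ => 1) (fun _ : Γ => 1) → M) :
    ∑ e, f e = ∑ a, f (.old a) + (∑ γ, f (.neg γ 0) + ∑ γ, f (.pos γ 0)) := by
  rw [← Equiv.sum_comp WithLoops.equivSum.symm, Fintype.sum_sum_type, Fintype.sum_sum_type]
  rfl

/-- The paths of length `n` that start at `u` and continue a path with surplus `t` of symbols
`γ(-)` to a path with nonzero `φ`-value. -/
def continuations (G : LabeledDigraph V E L) (v : V) (Kneg Kpos : Γ → ℕ) (n : ℕ) (u : V)
    (t : List Γ) : Set (List (WithLoops E Kneg Kpos)) :=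
  {p | p.length = n ∧ (∀ e ∈ p.head?, (G.attachLoops v Kneg Kpos).src e = u) ∧
    (G.attachLoops v Kneg Kpos).IsPath p ∧
    DyckInverseMonoid.negStack t *
      (p.map fun e => ((G.attachLoops v Kneg Kpos).label e).phi).prod ≠ DyckInverseMonoid.zero Γ}

variable {G : LabeledDigraph V E L} {v : V} {Kneg Kpos : Γ → ℕ} {n : ℕ} {u : V} {t : List Γ}
  {p : List (WithLoops E Kneg Kpos)}

theorem continuations_zero : continuations G v Kneg Kpos 0 u t = {[]} := by
  ext p
  cases p with
  | nil =>
    simpa [continuations, LabeledDigraph.IsPath] using DyckInverseMonoid.negStack_ne_zero t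
  | cons e p => simp [continuations]

theorem cons_mem_continuations {e : WithLoops E Kneg Kpos} :
    e :: p ∈ continuations G v Kneg Kpos (n + 1) u t ↔
      (G.attachLoops v Kneg Kpos).src e = u ∧ p.length = n ∧
      (∀ f ∈ p.head?, (G.attachLoops v Kneg Kpos).src f = (G.attachLoops v Kneg Kpos).tgt e) ∧
      (G.attachLoops v Kneg Kpos).IsPath p ∧
      DyckInverseMonoid.negStack t * ((G.attachLoops v Kneg Kpos).label e).phi *
        (p.map fun e => ((G.attachLoops v Kneg Kpos).label e).phi).prod ≠
          DyckInverseMonoid.zero Γ := by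
  simp only [continuations, LabeledDigraph.IsPath, Set.mem_ofPred_eq, List.length_cons,
    List.head?_cons, Option.mem_def, Option.some.injEq, forall_eq', List.isChain_cons,
    List.map_cons, List.prod_cons, mul_assoc, add_left_inj]
  constructor
  · rintro ⟨h1, h2, ⟨h3, h4⟩, h5⟩
    exact ⟨h2, h1, fun f hf => (h3 f hf).symm, h4, h5⟩
  · rintro ⟨h2, h1, h3, h4, h5⟩
    exact ⟨h1, h2, ⟨fun f hf => (h3 f hf).symm, h4⟩, h5⟩

theorem old_cons_mem_continuations {e : E} :
    .old e :: p ∈ continuations G v Kneg Kpos (n + 1) u t ↔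
      G.src e = u ∧ p ∈ continuations G v Kneg Kpos n (G.tgt e) t := by
  rw [cons_mem_continuations]
  change G.src e = u ∧ _ ∧ _ ∧ _ ∧ _ * 1 * _ ≠ _ ↔ _
  rw [mul_one]
  rfl

theorem neg_cons_mem_continuations {γ : Γ} {k : Fin (Kneg γ)} :
    .neg γ k :: p ∈ continuations G v Kneg Kpos (n + 1) u t ↔
      v = u ∧ p ∈ continuations G v Kneg Kpos n v (γ :: t) :=
  cons_mem_continuations

theorem pos_cons_mem_continuations_nil {γ : Γ} {k : Fin (Kpos γ)} :
    .pos γ k :: p ∈ continuations G v Kneg Kpos (n + 1) u [] ↔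
      v = u ∧ p ∈ continuations G v Kneg Kpos n v [] := by
  rw [cons_mem_continuations]
  change v = u ∧ _ ∧ _ ∧ _ ∧ 1 * DyckInverseMonoid.pos γ * _ ≠ _ ↔
    v = u ∧ _ ∧ _ ∧ _ ∧ 1 * _ ≠ _
  rw [one_mul, one_mul, Ne, DyckInverseMonoid.pos_mul_eq_zero_iff]
  rfl

theorem pos_cons_mem_continuations_cons {γ δ : Γ} {k : Fin (Kpos γ)} :
    .pos γ k :: p ∈ continuations G v Kneg Kpos (n + 1) u (δ :: t) ↔
      δ = γ ∧ v = u ∧ p ∈ continuations G v Kneg Kpos n v t := by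
  rw [cons_mem_continuations]
  change v = u ∧ _ ∧ _ ∧ _ ∧
    DyckInverseMonoid.negStack t * DyckInverseMonoid.neg δ * DyckInverseMonoid.pos γ * _ ≠ _ ↔ _
  rw [mul_assoc _ (DyckInverseMonoid.neg δ)]
  by_cases h : δ = γ
  · subst h
    rw [DyckInverseMonoid.neg_mul_pos_self, mul_one, eq_self, true_and]
    rfl
  · rw [DyckInverseMonoid.neg_mul_pos_of_ne h, DyckInverseMonoid.mul_zero_eq,
      DyckInverseMonoid.zero_mul_eq]
    simp [h]

end Loops

/-! ### Counting continuations in the bouquet. -/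

section Bouquet

variable {Γ : Type*} {J Q : ℕ}

/-- The number of steps that lead from a vertex of the bouquet back to the base. -/
def BouquetVertex.stepsToBase : BouquetVertex J Q → ℕ
  | .base => 0
  | .node _ q _ _ => Q - q

theorem BouquetVertex.stepsToBase_le (v : BouquetVertex J Q) : v.stepsToBase ≤ Q := by
  cases v <;> simp [stepsToBase]

/-- The range includes `q = Q`, where the circle has closed up at the base; `q = 0` is excluded
because the base counts as `0` steps, not `Q`. -/
theorem stepsToBase_bouquetVertexAt {q : ℕ} (j : Fin J) (h1 : 1 ≤ q) (hq : q ≤ Q) :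
    (bouquetVertexAt j q : BouquetVertex J Q).stepsToBase = Q - q := by
  rw [bouquetVertexAt]
  split_ifs <;> simp only [BouquetVertex.stepsToBase]
  omega

theorem bouquet_src_eq_base_iff {e : Fin J × Fin Q} :
    (bouquet J Q).src e = .base ↔ (e.2 : ℕ) = 0 := by
  have := e.2.isLt
  simp only [bouquet, bouquetVertexAt]
  split_ifs with h
  · simp; omega
  · simp; omega

theorem bouquet_src_eq_node_iff {e : Fin J × Fin Q} {j : Fin J} {q : ℕ} {h1 : 1 ≤ q}
    {h2 : q < Q} : (bouquet J Q).src e = .node j q h1 h2 ↔ e = (j, ⟨q, h2⟩) := by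
  obtain ⟨i, r, hr⟩ := e
  simp only [bouquet, bouquetVertexAt]
  split_ifs with h
  · simp
  · simp; omega

theorem bouquet_tgt (e : Fin J × Fin Q) :
    (bouquet J Q).tgt e = bouquetVertexAt e.1 (e.2 + 1) := rfl

/-- The number of continuations in the bouquet with loops. -/
noncomputable def continuationCount (n : ℕ) (u : BouquetVertex J Q) (t : List Γ) : ℕ :=
  (continuations (bouquet J Q) .base (fun _ : Γ => 1) (fun _ : Γ => 1) n u t).ncard

@[simp]
theorem continuationCount_zero (u : BouquetVertex J Q) (t : List Γ) :
    continuationCount 0 u t = 1 := by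
  rw [continuationCount, continuations_zero, Set.ncard_singleton]

theorem continuationCount_succ_eq_sum [Fintype Γ] (n : ℕ) (u : BouquetVertex J Q) (t : List Γ) :
    continuationCount (n + 1) u t =
      ∑ e, {p | e :: p ∈ continuations (bouquet J Q) .base (fun _ : Γ => 1) (fun _ : Γ => 1)
        (n + 1) u t}.ncard :=
  Set.ncard_eq_sum_ncard_cons fun _ hp => hp.1

theorem continuationCount_succ_node [Fintype Γ] (n : ℕ) (j : Fin J) (q : ℕ) (h1 : 1 ≤ q) (h2 : q < Q)
    (t : List Γ) : continuationCount (n + 1) (.node j q h1 h2) t =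
      continuationCount n (bouquetVertexAt j (q + 1) : BouquetVertex J Q) t := by
  rw [continuationCount_succ_eq_sum, WithLoops.sum_eq, Finset.sum_eq_single (j, ⟨q, h2⟩)]
  · cases t <;> simp [old_cons_mem_continuations, neg_cons_mem_continuations,
      pos_cons_mem_continuations_nil, pos_cons_mem_continuations_cons, bouquet_src_eq_node_iff,
      continuationCount, bouquet_tgt]
  · intro e _ he
    simp [old_cons_mem_continuations, bouquet_src_eq_node_iff, he]
  · simp

theorem sum_old_base (hQ : 1 ≤ Q) (n : ℕ) (t : List Γ) :
    ∑ e : Fin J × Fin Q, {p | .old e :: p ∈ continuations (bouquet J Q) .base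
      (fun _ : Γ => 1) (fun _ : Γ => 1) (n + 1) .base t}.ncard =
        ∑ j : Fin J, continuationCount n (bouquetVertexAt j 1 : BouquetVertex J Q) t := by
  rw [Fintype.sum_prod_type]
  refine Finset.sum_congr rfl fun j _ => ?_
  rw [Finset.sum_eq_single ⟨0, hQ⟩]
  · simp [old_cons_mem_continuations, bouquet_src_eq_base_iff, continuationCount, bouquet_tgt]
  · intro q _ hq
    have : (q : ℕ) ≠ 0 := fun h => hq (Fin.ext h)
    simp [old_cons_mem_continuations, bouquet_src_eq_base_iff, this]
  · simp

theorem continuationCount_succ_base_nil [Fintype Γ] (hQ : 1 ≤ Q) (n : ℕ) :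
    continuationCount (n + 1) (.base : BouquetVertex J Q) ([] : List Γ) =
      ∑ j : Fin J, continuationCount n (bouquetVertexAt j 1 : BouquetVertex J Q) ([] : List Γ) +
      (∑ γ : Γ, continuationCount n (.base : BouquetVertex J Q) [γ] +
        ∑ _γ : Γ, continuationCount n (.base : BouquetVertex J Q) ([] : List Γ)) := by
  rw [continuationCount_succ_eq_sum, WithLoops.sum_eq, sum_old_base hQ]
  simp [neg_cons_mem_continuations, pos_cons_mem_continuations_nil, continuationCount]

theorem continuationCount_succ_base_cons [Fintype Γ] (hQ : 1 ≤ Q) (n : ℕ) (δ : Γ) (t : List Γ) :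
    continuationCount (n + 1) (.base : BouquetVertex J Q) (δ :: t) =
      ∑ j : Fin J, continuationCount n (bouquetVertexAt j 1 : BouquetVertex J Q) (δ :: t) +
      (∑ γ : Γ, continuationCount n (.base : BouquetVertex J Q) (γ :: δ :: t) +
        continuationCount n (.base : BouquetVertex J Q) t) := by
  rw [continuationCount_succ_eq_sum, WithLoops.sum_eq, sum_old_base hQ]
  congr 2
  · simp [neg_cons_mem_continuations, continuationCount]
  · rw [Finset.sum_eq_single δ]
    · simp [pos_cons_mem_continuations_cons, continuationCount]
    · intro γ _ hγ
      simp [pos_cons_mem_continuations_cons, hγ.symm]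
    · simp

/-! ### Exponential bounds from the root of the equation. -/

variable {z : ℝ}

/-- Induction on `n` through the recursion: inside a circle one edge costs one factor `z`, and at
the base the contributions add up to at least `J z^Q + N z + z = 1`. -/
theorem pow_stepsToBase_le_continuationCount [Fintype Γ] [Nonempty Γ] (hQ : 1 ≤ Q) (hz : 0 < z)
    (hz1 : z ≤ 1) (hroot : J * z ^ Q + (Fintype.card Γ + 1) * z = 1) (n : ℕ)
    (u : BouquetVertex J Q) (t : List Γ) :
    z ^ u.stepsToBase ≤ continuationCount n u t * z ^ n := by
  induction n generalizing u t with
  | zero => simpa using pow_le_one₀ hz.le hz1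
  | succ n ih =>
    have hN : (1 : ℝ) ≤ Fintype.card Γ := by exact_mod_cast Fintype.card_pos
    cases u with
    | node j q h1 h2 =>
      rw [continuationCount_succ_node, pow_succ, ← mul_assoc]
      have h := ih (bouquetVertexAt j (q + 1)) t
      rw [stepsToBase_bouquetVertexAt j (by omega) h2] at h
      rw [BouquetVertex.stepsToBase, show Q - q = Q - (q + 1) + 1 by omega, pow_succ]
      gcongr
    | base =>
      have hC : ∀ t : List Γ, J * z ^ Q ≤
          (∑ j : Fin J, (continuationCount n (bouquetVertexAt j 1 : BouquetVertex J Q) t : ℝ)) *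
            z ^ (n + 1) := by
        intro t
        rw [Finset.sum_mul]
        calc J * z ^ Q = ∑ _j : Fin J, z ^ Q := by simp
          _ ≤ _ := Finset.sum_le_sum fun j _ => ?_
        have h := ih (bouquetVertexAt j 1) t
        rw [stepsToBase_bouquetVertexAt j le_rfl hQ] at h
        -- After the first edge of a circle `Q - 1` steps remain.
        rw [pow_succ, ← mul_assoc, show z ^ Q = z ^ (Q - 1) * z by rw [← pow_succ]; congr; omega]
        gcongr
      have hB : ∀ t : List Γ,
          z ≤ continuationCount n (.base : BouquetVertex J Q) t * z ^ (n + 1) := by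
        intro t
        have h := ih .base t
        rw [BouquetVertex.stepsToBase, pow_zero] at h
        rw [pow_succ, ← mul_assoc]
        exact le_mul_of_one_le_left hz.le h
      have hS : ∀ t : List Γ, Fintype.card Γ * z ≤
          (∑ γ : Γ, (continuationCount n (.base : BouquetVertex J Q) (γ :: t) : ℝ)) *
            z ^ (n + 1) := by
        intro t
        rw [Finset.sum_mul]
        calc (Fintype.card Γ : ℝ) * z = ∑ _γ : Γ, z := by simp
          _ ≤ _ := Finset.sum_le_sum fun γ _ => hB (γ :: t)
      rw [BouquetVertex.stepsToBase, pow_zero]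
      cases t with
      | nil =>
        rw [continuationCount_succ_base_nil hQ]
        push_cast
        rw [Finset.sum_const, Finset.card_univ, nsmul_eq_mul, add_mul, add_mul, mul_assoc]
        have h1 := hC []
        have h2 := hS []
        have h3 := hB []
        -- On the empty stack there are `N` choices of `γ(+)` where `hroot` needs only one; `hN`
        -- closes the gap.
        nlinarith
      | cons δ t =>
        rw [continuationCount_succ_base_cons hQ]
        push_cast
        rw [add_mul, add_mul]
        have h1 := hC (δ :: t)
        have h2 := hS (δ :: t)
        have h3 := hB t
        linarith

/-- The weight `N⁻¹ ^ t.length` exchanges the roles of pushes and pops: the `N` pushes together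
contribute `z` and the pop contributes `N z`, so on nonempty stacks it balances by the same
equation. Its coefficient `n` grows by one per step, which pays for the surplus at the empty stack.
The extra `z ^ Q` on the left makes the case `n = 0` hold at every vertex, as `stepsToBase` is at
most `Q`. -/
theorem continuationCount_le [Fintype Γ] [Nonempty Γ] (hQ : 1 ≤ Q) (hz : 0 < z) (hz1 : z ≤ 1)
    (hroot : J * z ^ Q + (Fintype.card Γ + 1) * z = 1) (n : ℕ)
    (u : BouquetVertex J Q) (t : List Γ) :
    continuationCount n u t * z ^ (n + Q) ≤
      z ^ u.stepsToBase * (1 + n * (Fintype.card Γ : ℝ)⁻¹ ^ t.length) := by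
  induction n generalizing u t with
  | zero => simpa using pow_le_pow_of_le_one hz.le hz1 u.stepsToBase_le
  | succ n ih =>
    have hN : (1 : ℝ) ≤ Fintype.card Γ := by exact_mod_cast Fintype.card_pos
    set N : ℝ := (Fintype.card Γ : ℝ) with hNdef
    have hNz : N * N⁻¹ = 1 := mul_inv_cancel₀ (by positivity)
    have hNi : 0 < N⁻¹ := by positivity
    rw [show n + 1 + Q = n + Q + 1 by ring]
    cases u with
    | node j q h1 h2 =>
      rw [continuationCount_succ_node, pow_succ, ← mul_assoc]
      have h := ih (bouquetVertexAt j (q + 1)) t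
      rw [stepsToBase_bouquetVertexAt j (by omega) h2] at h
      rw [BouquetVertex.stepsToBase, show Q - q = Q - (q + 1) + 1 by omega, pow_succ,
        mul_right_comm (z ^ (Q - (q + 1)))]
      refine mul_le_mul_of_nonneg_right (h.trans ?_) hz.le
      gcongr
      simp
    | base =>
      have hC : ∀ t : List Γ,
          (∑ j : Fin J, (continuationCount n (bouquetVertexAt j 1 : BouquetVertex J Q) t : ℝ)) *
            z ^ (n + Q + 1) ≤ J * (z ^ Q * (1 + n * N⁻¹ ^ t.length)) := by
        intro t
        rw [Finset.sum_mul]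
        calc _ ≤ ∑ _j : Fin J, z ^ Q * (1 + n * N⁻¹ ^ t.length) :=
              Finset.sum_le_sum fun j _ => ?_
          _ = _ := by simp
        have h := ih (bouquetVertexAt j 1) t
        rw [stepsToBase_bouquetVertexAt j le_rfl hQ] at h
        rw [pow_succ, ← mul_assoc,
          show z ^ Q = z ^ (Q - 1) * z by rw [← pow_succ]; congr; omega, mul_right_comm _ z]
        gcongr
      have hB : ∀ t : List Γ, continuationCount n (.base : BouquetVertex J Q) t *
          z ^ (n + Q + 1) ≤ (1 + n * N⁻¹ ^ t.length) * z := by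
        intro t
        have h := ih .base t
        rw [BouquetVertex.stepsToBase, pow_zero, one_mul] at h
        rw [pow_succ, ← mul_assoc]
        gcongr
      have hS : ∀ t : List Γ,
          (∑ γ : Γ, (continuationCount n (.base : BouquetVertex J Q) (γ :: t) : ℝ)) *
            z ^ (n + Q + 1) ≤ N * ((1 + n * N⁻¹ ^ (t.length + 1)) * z) := by
        intro t
        rw [Finset.sum_mul]
        calc _ ≤ ∑ _γ : Γ, (1 + n * N⁻¹ ^ (t.length + 1)) * z :=
              Finset.sum_le_sum fun γ _ => hB (γ :: t)
          _ = _ := by simp [hNdef]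
      rw [BouquetVertex.stepsToBase, pow_zero, one_mul]
      have hJ : J * z ^ Q = 1 - (N + 1) * z := by linarith
      cases t with
      | nil =>
        rw [continuationCount_succ_base_nil hQ]
        push_cast
        rw [Finset.sum_const, Finset.card_univ, nsmul_eq_mul, add_mul, add_mul, mul_assoc]
        have h1 := hC []
        have h2 := hS []
        have h3 := mul_le_mul_of_nonneg_left (hB []) (zero_le_one.trans hN)
        rw [← mul_assoc, hJ] at h1
        have h4 : N * ((1 + n * N⁻¹ ^ (0 + 1)) * z) = N * z + n * z := by
          linear_combination n * z * hNz
        simp only [List.length_nil, pow_zero, mul_one] at h1 h2 h3 ⊢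
        rw [h4] at h2
        -- The three bounds add up to `1 + n + (N - 1) z`; by `hJ` this nonnegativity gives `(N + 1)
        -- z ≤ 1`, so the surplus is at most `1`.
        have h5 : 0 ≤ J * z ^ Q := by positivity
        linarith
      | cons δ t =>
        rw [continuationCount_succ_base_cons hQ]
        push_cast
        rw [add_mul, add_mul]
        have h1 := hC (δ :: t)
        have h2 := hS (δ :: t)
        have h3 := hB t
        rw [← mul_assoc, hJ] at h1
        simp only [List.length_cons] at h1 h2 h3 ⊢
        have h4 : N * ((1 + n * N⁻¹ ^ (t.length + 1 + 1)) * z) =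
            N * z + n * N⁻¹ ^ (t.length + 1) * z := by
          linear_combination n * N⁻¹ ^ (t.length + 1) * z * hNz
        have h5 : (1 + n * N⁻¹ ^ t.length) * z = z + N * (n * N⁻¹ ^ (t.length + 1)) * z := by
          linear_combination - n * N⁻¹ ^ t.length * z * hNz
        rw [h4] at h2
        rw [h5] at h3
        -- Here the bounds add up to exactly `1 + n * N⁻¹ ^ (t.length + 1)`; the increment of `n` is
        -- pure slack.
        have h6 : 0 ≤ N⁻¹ ^ (t.length + 1) := by positivity
        linarith

/-! ### From continuations to words of the subshift. -/

theorem attachLoops_bouquet_label (v : BouquetVertex J Q)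
    (p : List (WithLoops (Fin J × Fin Q) (fun _ : Γ => 1) (fun _ : Γ => 1))) :
    p.map ((bouquet J Q).attachLoops v _ _).label = p := by
  refine (List.map_congr_left fun e _ => ?_).trans (List.map_id p)
  cases e <;> rfl

theorem mem_languageOfLength_bouquetSubshift [Nonempty Γ] {n : ℕ}
    {w : List (WithLoops (Fin J × Fin Q) (fun _ : Γ => 1) (fun _ : Γ => 1))} :
    w ∈ (bouquetSubshift Γ J Q).languageOfLength n ↔
      w.length = n ∧ ((bouquet J Q).attachLoops .base _ _).IsPath w ∧
      (w.map fun e => (((bouquet J Q).attachLoops .base _ _).label e).phi).prod ≠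
        DyckInverseMonoid.zero Γ := by
  rw [Subshift.languageOfLength, language_bouquetSubshift]
  simp only [admissibleWords, attachLoops_bouquet_label, Set.mem_ofPred_eq]
  constructor
  · rintro ⟨⟨p, h1, h2, rfl⟩, h⟩
    exact ⟨h, h1, h2⟩
  · rintro ⟨h, h1, h2⟩
    exact ⟨⟨w, h1, h2, rfl⟩, h⟩

theorem one_le_ncard_languageOfLength [Fintype Γ] [Nonempty Γ] (hQ : 1 ≤ Q) (hz : 0 < z)
    (hz1 : z ≤ 1) (hroot : J * z ^ Q + (Fintype.card Γ + 1) * z = 1) (n : ℕ) :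
    1 ≤ ((bouquetSubshift Γ J Q).languageOfLength n).ncard * z ^ n := by
  have h := pow_stepsToBase_le_continuationCount (Γ := Γ) (J := J) hQ hz hz1 hroot n .base []
  rw [BouquetVertex.stepsToBase, pow_zero] at h
  refine h.trans ?_
  gcongr
  refine Set.ncard_le_ncard ?_ ((List.finite_length_eq _ n).subset fun w hw => hw.2)
  rintro w ⟨h1, _, h3, h4⟩
  rw [DyckInverseMonoid.negStack, one_mul] at h4
  exact mem_languageOfLength_bouquetSubshift.2 ⟨h1, h3, h4⟩

/-- A word may start at any vertex. Removing its first letter leaves a path from the target of that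
letter whose product is still nonzero, that is, a continuation with empty stack; the alphabet size
bounds the choices of the letter. -/
theorem ncard_languageOfLength_succ_le [Fintype Γ] [Nonempty Γ] (hQ : 1 ≤ Q) (hz : 0 < z)
    (hz1 : z ≤ 1) (hroot : J * z ^ Q + (Fintype.card Γ + 1) * z = 1) (n : ℕ) :
    ((bouquetSubshift Γ J Q).languageOfLength (n + 1)).ncard * z ^ (n + Q) ≤
      Fintype.card (WithLoops (Fin J × Fin Q) (fun _ : Γ => 1) (fun _ : Γ => 1)) * (1 + n) := by
  rw [Set.ncard_eq_sum_ncard_cons fun _ hp => hp.2, Nat.cast_sum, Finset.sum_mul,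
    ← nsmul_eq_mul, ← Finset.card_univ]
  refine Finset.sum_le_card_nsmul _ _ _ fun e _ => ?_
  set u := ((bouquet J Q).attachLoops .base (fun _ : Γ => 1) (fun _ : Γ => 1)).tgt e
  have h := continuationCount_le (Γ := Γ) (J := J) hQ hz hz1 hroot n u []
  simp only [List.length_nil, pow_zero, mul_one] at h
  refine le_trans ?_ (h.trans (mul_le_of_le_one_left (by positivity) (pow_le_one₀ hz.le hz1)))
  gcongr
  refine Set.ncard_le_ncard ?_ ((List.finite_length_eq _ n).subset fun w hw => hw.1)
  intro w hw
  obtain ⟨h1, h2, h3⟩ := mem_languageOfLength_bouquetSubshift.1 hw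
  have h2' := List.isChain_cons.1 h2
  refine ⟨by simpa using h1, fun f hf => (h2'.1 f hf).symm, h2'.2, ?_⟩
  rw [DyckInverseMonoid.negStack, one_mul]
  intro h0
  apply h3
  rw [List.map_cons, List.prod_cons, h0, DyckInverseMonoid.mul_zero_eq]

end Bouquet

/-! ### The limit, the root, and the conclusion. -/

theorem tendsto_inv_mul_log_of_bounds {a : ℕ → ℝ} {z C : ℝ} (hz : 0 < z) (hC : 0 < C)
    (hlow : ∀ n, 1 ≤ a n * z ^ n) (hupp : ∀ n, a (n + 1) * z ^ (n + 1) ≤ C * (1 + n)) :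
    Tendsto (fun n : ℕ => 1 / (n : ℝ) * Real.log (a n)) atTop (𝓝 (-Real.log z)) := by
  have hpos : ∀ n, 0 < a n := fun n =>
    pos_of_mul_pos_left (zero_lt_one.trans_le (hlow n)) (by positivity)
  have hlog : ∀ n, Real.log (a n * z ^ n) = Real.log (a n) + n * Real.log z := fun n => by
    rw [Real.log_mul (hpos n).ne' (by positivity), Real.log_pow]
  have hdiv : Tendsto (fun n : ℕ => Real.log (n : ℝ) / n) atTop (𝓝 0) :=
    (Real.isLittleO_log_id_atTop.tendsto_div_nhds_zero).comp tendsto_natCast_atTop_atTop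
  have hlim : Tendsto (fun n : ℕ => Real.log C / n + Real.log (n : ℝ) / n - Real.log z) atTop
      (𝓝 (-Real.log z)) := by
    simpa using ((tendsto_const_div_atTop_nhds_zero_nat (Real.log C)).add hdiv).sub_const
      (Real.log z)
  refine tendsto_of_tendsto_of_tendsto_of_le_of_le' tendsto_const_nhds hlim ?_ ?_
  · filter_upwards [eventually_gt_atTop 0] with n hn
    have hn' : (0 : ℝ) < n := by exact_mod_cast hn
    have h := Real.log_nonneg (hlow n)
    rw [hlog] at h
    rw [one_div, ← div_eq_inv_mul, le_div_iff₀ hn']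
    linarith
  · filter_upwards [eventually_gt_atTop 0] with n hn
    have hn' : (0 : ℝ) < n := by exact_mod_cast hn
    obtain ⟨m, rfl⟩ : ∃ m, n = m + 1 := ⟨n - 1, by omega⟩
    have h := Real.log_le_log (zero_lt_one.trans_le (hlow _)) (hupp m)
    rw [hlog, show (1 + m : ℝ) = ((m + 1 : ℕ) : ℝ) by push_cast; ring,
      Real.log_mul hC.ne' hn'.ne'] at h
    rw [one_div, ← div_eq_inv_mul, ← add_div, div_le_iff₀ hn', sub_mul,
      div_mul_cancel₀ _ hn'.ne']
    linarith

theorem exists_pos_root {c d : ℝ} {Q : ℕ} (hQ : 1 ≤ Q) (hc : 0 < c) (hd : 0 < d) :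
    ∃ z : ℝ, 0 < z ∧ z ^ Q + c * z = d := by
  have hcont : ContinuousOn (fun z : ℝ => z ^ Q + c * z) (Set.Icc 0 (d / c)) := by fun_prop
  have hdc : 0 < d / c := by positivity
  obtain ⟨z, hz, h⟩ := intermediate_value_Icc hdc.le hcont
    -- At `d / c` the linear term alone already equals `d`.
    (show d ∈ Set.Icc _ _ by
      constructor
      · simpa [show Q ≠ 0 by omega] using hd.le
      · change d ≤ (d / c) ^ Q + c * (d / c)
        rw [mul_div_cancel₀ _ hc.ne']
        exact le_add_of_nonneg_left (by positivity))
  refine ⟨z, lt_of_le_of_ne hz.1 ?_, h⟩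
  rintro rfl
  simp [show Q ≠ 0 by omega] at h
  exact hd.ne h

theorem corollary2p6 {Γ : Type*} [Fintype Γ] (N J Q : ℕ) (hΓ : Fintype.card Γ = N)
    (hN : 1 < N) (hJ : 1 ≤ J) (hQ : 1 ≤ Q) :
    ∃ z : ℝ,
      (0 < z ∧ z ^ Q + ((N : ℝ) + 1) / (J : ℝ) * z - 1 / (J : ℝ) = 0) ∧
      (∀ y : ℝ, 0 < y → y ^ Q + ((N : ℝ) + 1) / (J : ℝ) * y - 1 / (J : ℝ) = 0 → y = z) ∧
      (bouquetSubshift Γ J Q).HasEntropy (-Real.log z) := by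
  have hJ' : (0 : ℝ) < J := by exact_mod_cast hJ
  have hc : 0 < ((N : ℝ) + 1) / J := by positivity
  have hΓ' : Nonempty Γ := Fintype.card_pos_iff.1 (by omega)
  obtain ⟨z, hz, hroot⟩ := exists_pos_root hQ hc (one_div_pos.2 hJ')
  refine ⟨z, ⟨hz, by linarith⟩, fun y hy h => ?_, ?_⟩
  · rcases lt_trichotomy y z with hlt | heq | hlt
    · have h1 := pow_le_pow_left₀ hy.le hlt.le Q
      have h2 := mul_lt_mul_of_pos_left hlt hc
      linarith
    · exact heq
    · have h1 := pow_le_pow_left₀ hz.le hlt.le Q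
      have h2 := mul_lt_mul_of_pos_left hlt hc
      linarith
  · subst hΓ
    have hroot' : J * z ^ Q + (Fintype.card Γ + 1) * z = 1 := by
      field_simp at hroot
      linarith
    have hz1 : z ≤ 1 := by
      have : 0 ≤ J * z ^ Q := by positivity
      have : 0 ≤ (Fintype.card Γ : ℝ) * z := by positivity
      linarith
    set A : ℕ := Fintype.card (WithLoops (Fin J × Fin Q) (fun _ : Γ => 1) (fun _ : Γ => 1))
    -- Dividing by `z ^ Q` compensates for the exponent `n + Q` in the upper bound; `A + 1` instead
    -- of `A` makes positivity immediate.
    refine tendsto_inv_mul_log_of_bounds (C := (A + 1) / z ^ Q) hz (by positivity)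
      (one_le_ncard_languageOfLength hQ hz hz1 hroot') fun n => ?_
    rw [div_mul_eq_mul_div, le_div_iff₀ (by positivity)]
    have h := ncard_languageOfLength_succ_le hQ hz hz1 hroot' n
    calc _ = ((bouquetSubshift Γ J Q).languageOfLength (n + 1)).ncard * z ^ (n + Q) * z := by ring
      _ ≤ A * (1 + n) * z := by gcongr
      _ ≤ A * (1 + n) := mul_le_of_le_one_right (by positivity) hz1
      _ ≤ (A + 1) * (1 + n) := by gcongr; linarith
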